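/- Let $\Sigma$ be the closed unit disk in the plane and let $X:\Sigma\to\mathbb{R}^3$ be an immersion of class $\mathcal{C}^r$ up to the boundary, $4\le r\le\infty$, with unit normal $\nu$, mean curvature $H$ (the mean of the principal curvatures with respect to $\nu$), Gaussian curvature $K$ and area element $d\Sigma$. Let $\kappa\ge 0$, $\tau$ and $s$ be the Frenet curvature, the Frenet torsion and the arc length of the positively oriented boundary curve. Let $\sigma>0$, let $c_o,\eta,\varpi,\beta\in\mathbb{R}$, let $p\ge 0$ be an integer, and let $\Lambda$ be a real analytic function on an open set $U\subset\mathbb{R}$ that contains all values of $\kappa$. Consider the energy $$F[X]=\sigma\int_\Sigma (H-c_o)^p\,d\Sigma+\eta\int_\Sigma K\,d\Sigma+\oint_{\partial\Sigma}\bigl(\Lambda(\kappa)+\varpi\tau+\beta\bigr)\,ds .$$ Suppose that $p\ne 0$, that $X(\Sigma)$ is contained in an affine plane (a planar disk, not necessarily round or embedded), and that $X$ is critical for $F$: for every $V:\Sigma\to\mathbb{R}^3$ of class $\mathcal{C}^r$ up to the boundary, with no boundary condition, $\varepsilon\mapsto F[X+\varepsilon V]$ has derivative $0$ at $\varepsilon=0$.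 Write $\kappa(s)$, $s\in\mathbb{R}$, for the curvature of the boundary curve parametrized by arc length and traversed repeatedly, and $\dot\Lambda$ for the derivative of $\Lambda$. Then for every period $\rho$ of the function $\kappa$ (in particular for its least positive period if $\kappa$ is not constant, and for every real number $\rho$ if the boundary is a circle), $$\int_0^\rho\bigl(\kappa\dot\Lambda(\kappa)-\Lambda(\kappa)-\beta\bigr)\,ds=0 .$$ -/

import Mathlib

noncomputable section

namespace PWillmore

/-- The parameter plane. -/
abbrev Plane : Type := EuclideanSpace ℝ (Fin 2)

/-- The ambient Euclidean space. -/
abbrev Space : Type := EuclideanSpace ℝ (Fin 3)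

/-- The closed unit disk: the standard model of a compact surface of disk type. -/
def disk : Set Plane := Metric.closedBall 0 1

/-- The cross product of Euclidean 3-space. -/
def cross (a b : Space) : Space :=
  WithLp.toLp 2 (crossProduct (WithLp.ofLp a) (WithLp.ofLp b))

section Curves

/-- Derivative with respect to arc length, along the regular curve `γ`, of a vector field `W`
(both are given as functions of the parameter of `γ`). -/
def arcDeriv (γ W : ℝ → Space) (t : ℝ) : Space := ‖deriv γ t‖⁻¹ • deriv W t

/-- Unit tangent `T`. -/
def tangent (γ : ℝ → Space) (t : ℝ) : Space := arcDeriv γ γ t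

/-- Frenet curvature `κ = ‖T'‖ ≥ 0` (prime is the derivative with respect to arc length). -/
def curvature (γ : ℝ → Space) (t : ℝ) : ℝ := ‖arcDeriv γ (tangent γ) t‖

/-- Frenet unit normal `N = T' / κ` (where `κ ≠ 0`). -/
def normal (γ : ℝ → Space) (t : ℝ) : Space := (curvature γ t)⁻¹ • arcDeriv γ (tangent γ) t

/-- Frenet unit binormal `B = T × N`. -/
def binormal (γ : ℝ → Space) (t : ℝ) : Space := cross (tangent γ t) (normal γ t)

/-- Frenet torsion `τ = N' ⬝ B`. -/
def torsion (γ : ℝ → Space) (t : ℝ) : ℝ := inner ℝ (arcDeriv γ (normal γ) t) (binormal γ t)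

end Curves

section Surfaces

/-- Partial derivative in the `i`-th coordinate direction. -/
def pderiv (i : Fin 2) (X : Plane → Space) (u : Plane) : Space :=
  fderiv ℝ X u (EuclideanSpace.single i 1)

/-- First fundamental form. -/
def firstForm (X : Plane → Space) (u : Plane) : Matrix (Fin 2) (Fin 2) ℝ :=
  Matrix.of fun i j => inner ℝ (pderiv i X u) (pderiv j X u)

/-- Unit normal `ν`. -/
def unitNormal (X : Plane → Space) (u : Plane) : Space :=
  ‖cross (pderiv 0 X u) (pderiv 1 X u)‖⁻¹ • cross (pderiv 0 X u) (pderiv 1 X u)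

/-- Second fundamental form with respect to `ν`. -/
def secondForm (X : Plane → Space) (u : Plane) : Matrix (Fin 2) (Fin 2) ℝ :=
  Matrix.of fun i j => inner ℝ (pderiv i (pderiv j X) u) (unitNormal X u)

/-- Mean curvature `H`, the mean of the principal curvatures. -/
def meanCurvature (X : Plane → Space) (u : Plane) : ℝ :=
  ((firstForm X u)⁻¹ * secondForm X u).trace / 2

/-- Gaussian curvature `K`, the product of the principal curvatures. -/
def gaussCurvature (X : Plane → Space) (u : Plane) : ℝ :=
  (secondForm X u).det / (firstForm X u).det

/-- Integral over the surface, with respect to its area element. -/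
def surfaceIntegral (X : Plane → Space) (f : Plane → ℝ) : ℝ :=
  ∫ u in disk, f u * Real.sqrt (firstForm X u).det

/-- The image under `X` of the boundary circle of the disk, positively oriented. -/
def boundaryCurve (X : Plane → Space) (t : ℝ) : Space := X !₂[Real.cos t, Real.sin t]

/-- Integral over the boundary of the surface, with respect to its line element. -/
def boundaryIntegral (X : Plane → Space) (f : ℝ → ℝ) : ℝ :=
  ∫ t in (0 : ℝ)..(2 * Real.pi), f t * ‖deriv (boundaryCurve X) t‖

/-- The energy
`F[X] = σ ∫_Σ (H - c₀)^p dΣ + η ∫_Σ K dΣ + ∮_{∂Σ} (Λ(κ) + ϖ τ + β) ds`. -/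
def energy (σ c₀ : ℝ) (p : ℕ) (η ϖ β : ℝ) (Λ : ℝ → ℝ) (X : Plane → Space) : ℝ :=
  σ * surfaceIntegral X (fun u => (meanCurvature X u - c₀) ^ p)
    + η * surfaceIntegral X (gaussCurvature X)
    + boundaryIntegral X (fun t =>
        Λ (curvature (boundaryCurve X) t) + ϖ * torsion (boundaryCurve X) t + β)

/-- `X` restricts to a `C^r` immersion of the closed disk. Being of class `C^r` up to the boundary
is expressed through an extension to the plane; nothing below depends on the extension. -/
structure IsDiskImmersion (r : ℕ∞) (X : Plane → Space) : Prop where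
  contDiff : ContDiff ℝ r X
  injective_fderiv : ∀ u ∈ disk, Function.Injective (fderiv ℝ X u)

/-- The surface lies in an affine plane of the ambient space. -/
def IsPlanar (X : Plane → Space) : Prop :=
  ∃ a n : Space, n ≠ 0 ∧ ∀ u ∈ disk, inner ℝ n (X u - a) = 0

/-- `X` is a critical point of `E`: the first variation `δE[X]` exists and vanishes for every
variation field `V` of class `C^r` (no condition on `V` at the boundary). -/
def IsCritical (r : ℕ∞) (E : (Plane → Space) → ℝ) (X : Plane → Space) : Prop :=
  ∀ V : Plane → Space, ContDiff ℝ r V → HasDerivAt (fun ε : ℝ => E (X + ε • V)) 0 0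

/-- `C : ℝ → ℝ³` is a parametrization by arc length of the positively oriented boundary curve
(traversed over and over again). -/
def IsArcLengthBoundary (X : Plane → Space) (C : ℝ → Space) : Prop :=
  ∃ θ : ℝ → ℝ, Differentiable ℝ θ ∧ (∀ s, 0 < deriv θ s) ∧ C = boundaryCurve X ∘ θ ∧
    ∀ s, ‖deriv C s‖ = 1

end Surfaces

end PWillmore

end

noncomputable section

namespace PWillmore

/-! Two variations of the planar disk suffice. The first is a normal variation `ψ n` with `ψ` zero
on the unit circle, so the boundary terms stay fixed. Since `X` is planar, the area density and the
total curvature change only at second order in `ε`, whereas `H` changes at first order by an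
elliptic operator applied to `ψ`. The first variation is therefore `σ p (-c₀)^(p-1) / 2` times the
integral of that linearization. A barrier `1 - |u|^(2k)` with `k` large makes the integrand negative
off the origin (`exists_adjTrace_neg`), so `c₀ = 0` (`spontaneousCurvature_eq_zero`).

The second is the dilation `V = X`. It preserves planarity, and with `c₀ = 0` and `p ≠ 0` the energy
of a planar disk is only `∮ (Λ(κ) + β) ds`. Under the factor `1 + ε` curvature is divided by `1 + ε`
and length multiplied by it; differentiating at `0` gives the claimed integral over the whole
boundary (`integral_rescaling_eq_zero`).

An arbitrary period `ρ` of `κ` is then compared with the length `L` of the boundary: either the two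
are commensurable, or they generate a dense group of periods and the integrand is constant
(`integral_eq_zero_of_periodic`). -/

open Set Filter Topology MeasureTheory

/-! ### Parameter integrals and periodic functions. -/

section Calculus

/-- Differentiation under the integral sign over a compact set, at the parameter `0`. -/
theorem hasDerivAt_setIntegral_of_continuousOn {α : Type*} [TopologicalSpace α] [T2Space α]
    [MeasurableSpace α] [OpensMeasurableSpace α]
    {μ : Measure α} [IsFiniteMeasureOnCompacts μ] {s : Set α} (hs : IsCompact s)
    {O : Set (ℝ × α)} (hO : IsOpen O) (hsO : ∀ x ∈ s, ((0 : ℝ), x) ∈ O)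
    {f f' : ℝ → α → ℝ} (hf : ContinuousOn (fun q : ℝ × α => f q.1 q.2) O)
    (hf' : ContinuousOn (fun q : ℝ × α => f' q.1 q.2) O)
    (hd : ∀ ε x, (ε, x) ∈ O → HasDerivAt (fun e => f e x) (f' ε x) ε) :
    HasDerivAt (fun ε => ∫ x in s, f ε x ∂μ) (∫ x in s, f' 0 x ∂μ) 0 := by
  -- A tube around `{0} × s` inside `O` contains a compact product, on which `f'` is bounded; that
  -- bound is the constant dominating function.
  obtain ⟨V, W, hV, -, hV0, hsW, hVW⟩ := generalized_tube_lemma (s := {(0 : ℝ)})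
    isCompact_singleton hs hO (by rintro ⟨e, x⟩ ⟨rfl, hx⟩; exact hsO x hx)
  obtain ⟨δ, hδ, hδV⟩ := Metric.isOpen_iff.1 hV 0 (hV0 rfl)
  have hsub : ∀ ε ∈ Metric.closedBall (0 : ℝ) (δ / 2), ∀ x ∈ s, (ε, x) ∈ O := fun ε hε x hx =>
    hVW ⟨hδV (Metric.closedBall_subset_ball (by linarith) hε), hsW hx⟩
  have hK : IsCompact (Metric.closedBall (0 : ℝ) (δ / 2) ×ˢ s) :=
    (isCompact_closedBall _ _).prod hs
  obtain ⟨M, hM⟩ := hK.exists_bound_of_continuousOn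
    (hf'.mono fun q hq => hsub q.1 hq.1 q.2 hq.2)
  have hslice : ∀ {g : ℝ → α → ℝ}, ContinuousOn (fun q : ℝ × α => g q.1 q.2) O →
      ∀ ε ∈ Metric.closedBall (0 : ℝ) (δ / 2), ContinuousOn (g ε) s := fun {g} hg ε hε =>
    hg.comp (f := fun x : α => (ε, x)) (by fun_prop) fun x hx => hsub ε hε x hx
  have h0 : (0 : ℝ) ∈ Metric.closedBall (0 : ℝ) (δ / 2) := Metric.mem_closedBall_self (by linarith)
  have hnhds : Metric.closedBall (0 : ℝ) (δ / 2) ∈ 𝓝 (0 : ℝ) :=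
    Metric.closedBall_mem_nhds _ (by linarith)
  refine (hasDerivAt_integral_of_dominated_loc_of_deriv_le (bound := fun _ => M) hnhds ?_ ?_ ?_
    ?_ ?_ ?_).2
  · filter_upwards [hnhds] with ε hε
    exact ((hslice hf ε hε).integrableOn_compact hs).aestronglyMeasurable
  · exact (hslice hf 0 h0).integrableOn_compact hs
  · exact ((hslice hf' 0 h0).integrableOn_compact hs).aestronglyMeasurable
  · filter_upwards [ae_restrict_mem hs.measurableSet] with x hx ε hε
    exact hM (ε, x) ⟨hε, hx⟩
  · exact integrableOn_const hs.measure_lt_top.ne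
  · filter_upwards [ae_restrict_mem hs.measurableSet] with x hx ε hε
    exact hd ε x (hsub ε hε x hx)

/-- If a continuous function has mean zero over one positive period, then it has mean zero over
every period. -/
theorem integral_eq_zero_of_periodic {f : ℝ → ℝ} (hf : Continuous f) {L ρ : ℝ} (hL : 0 < L)
    (hfL : Function.Periodic f L) (hfρ : Function.Periodic f ρ)
    (h0 : ∫ s in (0 : ℝ)..L, f s = 0) : ∫ s in (0 : ℝ)..ρ, f s = 0 := by
  -- Dense periods force a constant, which must be `0`. In the cyclic case `L = k a` and `ρ = m a`,
  -- so `k ρ = m L` and `k` times the integral over `ρ` is `m` times the one over `L`.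
  rcases (AddSubgroup.closure {L, ρ}).dense_or_cyclic with hd | ⟨a, ha⟩
  · have hper : ∀ x ∈ AddSubgroup.closure {L, ρ}, Function.Periodic f x := by
      intro x hx
      induction hx using AddSubgroup.closure_induction with
      | mem x hx =>
        rcases hx with rfl | rfl
        exacts [hfL, hfρ]
      | zero => intro y; simp
      | add x y _ _ hx hy => exact hx.add_period hy
      | neg x _ hx => exact hx.neg
    have hconst : f = fun _ => f 0 :=
      Continuous.ext_on hd hf continuous_const fun x hx => by simpa using hper x hx 0
    have hz : f 0 = 0 := by
      rw [hconst] at h0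
      simpa [hL.ne'] using h0
    rw [hconst, hz]
    simp
  · have hmem : ∀ x ∈ ({L, ρ} : Set ℝ), ∃ k : ℤ, k • a = x := fun x hx =>
      AddSubgroup.mem_closure_singleton.1 (ha ▸ AddSubgroup.subset_closure hx)
    obtain ⟨k, hk⟩ := hmem L (by simp)
    obtain ⟨m, hm⟩ := hmem ρ (by simp)
    have hint : ∀ t₁ t₂, IntervalIntegrable f volume t₁ t₂ := fun _ _ => hf.intervalIntegrable _ _
    have h1 := hfρ.intervalIntegral_add_zsmul_eq k 0 hint
    have h2 := hfL.intervalIntegral_add_zsmul_eq m 0 hint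
    have hkm : k • ρ = m • L := by
      rw [← hk, ← hm, smul_smul, smul_smul, mul_comm]
    rw [zero_add, hkm] at h1
    simp only [zero_add] at h1 h2
    rw [h2, h0, smul_zero] at h1
    have hk0 : k ≠ 0 := by
      rintro rfl
      simp at hk
      exact hL.ne hk
    exact (smul_eq_zero.1 h1.symm).resolve_left hk0

end Calculus

/-! ### Cross and triple products in three-space. -/

section VectorAlgebra

theorem inner_space_eq (a b : Space) :
    inner ℝ a b = a 0 * b 0 + a 1 * b 1 + a 2 * b 2 := by
  simp [PiLp.inner_apply, Fin.sum_univ_three, mul_comm]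

@[simp] theorem cross_zero_apply (a b : Space) : cross a b 0 = a 1 * b 2 - a 2 * b 1 := by
  simp [cross, cross_apply]

@[simp] theorem cross_one_apply (a b : Space) : cross a b 1 = a 2 * b 0 - a 0 * b 2 := by
  simp [cross, cross_apply]

@[simp] theorem cross_two_apply (a b : Space) : cross a b 2 = a 0 * b 1 - a 1 * b 0 := by
  simp [cross, cross_apply]

@[fun_prop]
theorem continuous_cross {α : Type*} [TopologicalSpace α] {f g : α → Space} (hf : Continuous f)
    (hg : Continuous g) : Continuous fun x => cross (f x) (g x) := by
  refine (PiLp.continuous_toLp 2 _).comp (continuous_pi fun i => ?_)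
  fin_cases i <;> simp [cross_apply] <;> fun_prop

/-- Cramer's rule: `det(a, b, c) n = ⟨n, a⟩ b × c + ⟨n, b⟩ c × a + ⟨n, c⟩ a × b`, checked coordinate
by coordinate. -/
theorem inner_cross_eq_zero {n a b c : Space} (hn : n ≠ 0) (ha : inner ℝ n a = 0)
    (hb : inner ℝ n b = 0) (hc : inner ℝ n c = 0) : inner ℝ a (cross b c) = 0 := by
  by_contra h
  apply hn
  rw [inner_space_eq] at ha hb hc
  have key : ∀ i, inner ℝ a (cross b c) * n i = 0 := by
    intro i
    rw [inner_space_eq]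
    fin_cases i
    · simp [-mul_eq_zero]
      linear_combination (b 1 * c 2 - b 2 * c 1) * ha + (c 1 * a 2 - c 2 * a 1) * hb +
        (a 1 * b 2 - a 2 * b 1) * hc
    · simp [-mul_eq_zero]
      linear_combination (b 2 * c 0 - b 0 * c 2) * ha + (c 2 * a 0 - c 0 * a 2) * hb +
        (a 2 * b 0 - a 0 * b 2) * hc
    · simp [-mul_eq_zero]
      linear_combination (b 0 * c 1 - b 1 * c 0) * ha + (c 0 * a 1 - c 1 * a 0) * hb +
        (a 0 * b 1 - a 1 * b 0) * hc
  ext i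
  simpa [h] using key i

theorem norm_cross_sq (a b : Space) :
    ‖cross a b‖ ^ 2 = inner ℝ a a * inner ℝ b b - inner ℝ a b * inner ℝ a b := by
  rw [← real_inner_self_eq_norm_sq]
  simp only [inner_space_eq, cross_zero_apply, cross_one_apply, cross_two_apply]
  ring

/-- Equality case of Cauchy–Schwarz: `⟨a, a⟩ b - ⟨a, b⟩ a` has squared norm `‖a‖² ‖a × b‖²`, so a
zero cross product yields a linear relation. -/
theorem cross_ne_zero {a b : Space} (h : ∀ x y : ℝ, x • a + y • b = 0 → x = 0 ∧ y = 0) :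
    cross a b ≠ 0 := by
  intro h0
  have h1 := norm_cross_sq a b
  have h2 : (-inner ℝ a b) • a + inner ℝ a a • b = 0 := by
    rw [← inner_self_eq_zero (𝕜 := ℝ)]
    simp only [inner_add_left, inner_add_right, inner_smul_left, inner_smul_right,
      real_inner_comm a b, conj_trivial]
    rw [h0, norm_zero] at h1
    linear_combination -(inner ℝ a a) * h1
  have ha : a = 0 := inner_self_eq_zero.1 (h _ _ h2).2
  have := (h 1 0 (by simp [ha])).1
  norm_num at this

theorem inner_cross_sq {n a b : Space} (ha : inner ℝ n a = 0) (hb : inner ℝ n b = 0) :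
    inner ℝ n (cross a b) ^ 2 = ‖n‖ ^ 2 * ‖cross a b‖ ^ 2 := by
  rw [← real_inner_self_eq_norm_sq, ← real_inner_self_eq_norm_sq]
  simp only [inner_space_eq, cross_zero_apply, cross_one_apply, cross_two_apply] at *
  linear_combination
    -((a 0 * a 0 + a 1 * a 1 + a 2 * a 2) * (n 0 * b 0 + n 1 * b 1 + n 2 * b 2)
      - 2 * (a 0 * b 0 + a 1 * b 1 + a 2 * b 2) * (n 0 * a 0 + n 1 * a 1 + n 2 * a 2)) * hb
    - (b 0 * b 0 + b 1 * b 1 + b 2 * b 2) * (n 0 * a 0 + n 1 * a 1 + n 2 * a 2) * ha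

end VectorAlgebra

/-! ### Vanishing of torsion and of the second fundamental form. -/

section Planarity

/-- No differentiability is required because the default derivative is `0`. This matters for the
Frenet normal, which may fail to be differentiable where the curvature vanishes. -/
theorem inner_deriv_eq_zero {n : Space} {c : ℝ} {W : ℝ → Space}
    (h : ∀ t, inner ℝ n (W t) = c) (t : ℝ) : inner ℝ n (deriv W t) = 0 := by
  by_cases hW : DifferentiableAt ℝ W t
  · have h1 := ((hasDerivAt_const t n).inner ℝ hW.hasDerivAt).deriv
    simp only [h, deriv_const, inner_zero_left, add_zero] at h1
    exact h1.symm
  · rw [deriv_zero_of_not_differentiableAt hW, inner_zero_right]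

theorem torsion_eq_zero {n : Space} (hn : n ≠ 0) {c : ℝ} {γ : ℝ → Space}
    (h : ∀ t, inner ℝ n (γ t) = c) (t : ℝ) : torsion γ t = 0 := by
  have harc : ∀ {W : ℝ → Space} {c : ℝ}, (∀ t, inner ℝ n (W t) = c) →
      ∀ t, inner ℝ n (arcDeriv γ W t) = 0 := fun hW t => by
    rw [arcDeriv, inner_smul_right, inner_deriv_eq_zero hW, mul_zero]
  have hT : ∀ t, inner ℝ n (tangent γ t) = 0 := harc h
  have hN : ∀ t, inner ℝ n (normal γ t) = 0 := fun t => by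
    rw [normal, inner_smul_right, harc hT, mul_zero]
  exact inner_cross_eq_zero hn (harc hN t) (hT t) (hN t)

/-- Restricted to the open ball: the extension of `X` need not stay in the plane outside the disk.
The boundary circle is null, so area integrals do not see the difference. -/
theorem inner_fderiv_eq_zero {n : Space} {c : ℝ} {Y : Plane → Space}
    (h : ∀ u ∈ Metric.ball (0 : Plane) 1, inner ℝ n (Y u) = c) {u : Plane}
    (hu : u ∈ Metric.ball (0 : Plane) 1) (v : Plane) : inner ℝ n (fderiv ℝ Y u v) = 0 := by
  by_cases hY : DifferentiableAt ℝ Y u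
  · have h1 := (hasFDerivAt_const n u).inner ℝ hY.hasFDerivAt
    have h2 : (fun u => inner ℝ n (Y u)) =ᶠ[𝓝 u] fun _ => c := by
      filter_upwards [Metric.isOpen_ball.mem_nhds hu] with w hw using h w hw
    have h3 := DFunLike.congr_fun (h1.unique ((hasFDerivAt_const c u).congr_of_eventuallyEq h2)) v
    simpa [fderivInnerCLM_apply] using h3
  · simp [fderiv_zero_of_not_differentiableAt hY]

theorem inner_pderiv_eq_zero {n : Space} {c : ℝ} {X : Plane → Space}
    (h : ∀ u ∈ Metric.ball (0 : Plane) 1, inner ℝ n (X u) = c) {u : Plane}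
    (hu : u ∈ Metric.ball (0 : Plane) 1) (i : Fin 2) : inner ℝ n (pderiv i X u) = 0 :=
  inner_fderiv_eq_zero h hu _

theorem inner_pderiv_pderiv_eq_zero {n : Space} {c : ℝ} {X : Plane → Space}
    (h : ∀ u ∈ Metric.ball (0 : Plane) 1, inner ℝ n (X u) = c) {u : Plane}
    (hu : u ∈ Metric.ball (0 : Plane) 1) (i j : Fin 2) :
    inner ℝ n (pderiv i (pderiv j X) u) = 0 :=
  inner_pderiv_eq_zero (fun _ hw => inner_pderiv_eq_zero h hw j) hu i

theorem secondForm_eq_zero {n : Space} (hn : n ≠ 0) {c : ℝ} {X : Plane → Space}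
    (h : ∀ u ∈ Metric.ball (0 : Plane) 1, inner ℝ n (X u) = c) {u : Plane}
    (hu : u ∈ Metric.ball (0 : Plane) 1) : secondForm X u = 0 := by
  ext i j
  simp only [secondForm, Matrix.of_apply, unitNormal, inner_smul_right, Matrix.zero_apply]
  rw [inner_cross_eq_zero hn (inner_pderiv_pderiv_eq_zero h hu i j) (inner_pderiv_eq_zero h hu 0)
    (inner_pderiv_eq_zero h hu 1), mul_zero]

theorem ball_ae_eq_disk : Metric.ball (0 : Plane) 1 =ᵐ[volume] disk := by
  refine Metric.ball_subset_closedBall.eventuallyLE.antisymm ?_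
  rw [ae_le_set, Metric.closedBall_sdiff_ball]
  exact Measure.addHaar_sphere _ _ _

theorem surfaceIntegral_eq {X : Plane → Space} {f g : Plane → ℝ}
    (h : ∀ u ∈ Metric.ball (0 : Plane) 1, f u * Real.sqrt (firstForm X u).det = g u) :
    surfaceIntegral X f = ∫ u in disk, g u := by
  rw [surfaceIntegral, ← setIntegral_congr_set ball_ae_eq_disk,
    ← setIntegral_congr_set ball_ae_eq_disk]
  exact setIntegral_congr_fun measurableSet_ball h

theorem energy_eq_boundaryIntegral (σ η ϖ β : ℝ) {p : ℕ} (hp : p ≠ 0) (Λ : ℝ → ℝ) {n : Space}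
    (hn : n ≠ 0) {c : ℝ} {X : Plane → Space} (h : ∀ u ∈ disk, inner ℝ n (X u) = c) :
    energy σ 0 p η ϖ β Λ X =
      boundaryIntegral X fun t => Λ (curvature (boundaryCurve X) t) + β := by
  have hb : ∀ u ∈ Metric.ball (0 : Plane) 1, inner ℝ n (X u) = c := fun u hu =>
    h u (Metric.ball_subset_closedBall hu)
  have hγ : ∀ t, inner ℝ n (boundaryCurve X t) = c := fun t => h _ (by
    simp [disk, EuclideanSpace.norm_eq])
  rw [energy, surfaceIntegral_eq (g := fun _ => 0), surfaceIntegral_eq (g := fun _ => 0)]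
  · simp [torsion_eq_zero hn hγ]
  · intro u hu
    simp [gaussCurvature, secondForm_eq_zero hn hb hu]
  · intro u hu
    simp [meanCurvature, secondForm_eq_zero hn hb hu, hp]

end Planarity

/-! ### Regularity, periodicity and scaling of the boundary curve. -/

section BoundaryCurve

theorem contDiff_arcDeriv {γ W : ℝ → Space} {k : ℕ∞} (hγ : ContDiff ℝ (k + 1) γ)
    (hW : ContDiff ℝ (k + 1) W) (h0 : ∀ t, deriv γ t ≠ 0) : ContDiff ℝ k (arcDeriv γ W) := by
  have h1 : ContDiff ℝ k (deriv γ) := hγ.deriv'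
  have h2 : ContDiff ℝ k (deriv W) := hW.deriv'
  exact ((h1.norm ℝ h0).inv fun t => norm_ne_zero_iff.2 (h0 t)).smul h2

theorem continuous_curvature {γ : ℝ → Space} (hγ : ContDiff ℝ 2 γ) (h0 : ∀ t, deriv γ t ≠ 0) :
    Continuous (curvature γ) := by
  have h1 : ContDiff ℝ (1 : ℕ∞) (tangent γ) :=
    contDiff_arcDeriv (by simpa [one_add_one_eq_two] using hγ)
      (by simpa [one_add_one_eq_two] using hγ) h0
  have h2 : ContDiff ℝ (0 : ℕ∞) (arcDeriv γ (tangent γ)) :=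
    contDiff_arcDeriv (by simpa using hγ.of_le (by norm_num)) (by simpa using h1) h0
  exact h2.continuous.norm

theorem periodic_deriv {W : ℝ → Space} {c : ℝ} (h : Function.Periodic W c) :
    Function.Periodic (deriv W) c := fun t => by
  rw [← deriv_comp_add_const, funext h]

theorem periodic_curvature {γ : ℝ → Space} {c : ℝ} (h : Function.Periodic γ c) :
    Function.Periodic (curvature γ) c := by
  have harc : ∀ {W : ℝ → Space}, Function.Periodic W c → Function.Periodic (arcDeriv γ W) c :=
    fun hW t => by simp only [arcDeriv, periodic_deriv h t, periodic_deriv hW t]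
  have hT : Function.Periodic (tangent γ) c := harc h
  intro t
  rw [curvature, harc hT, curvature]

theorem periodic_boundaryCurve (X : Plane → Space) :
    Function.Periodic (boundaryCurve X) (2 * Real.pi) := fun t => by
  simp [boundaryCurve]

theorem boundaryCurve_mem {t : ℝ} : (!₂[Real.cos t, Real.sin t] : Plane) ∈ disk := by
  simp [disk, EuclideanSpace.norm_eq]

theorem hasDerivAt_circle (t : ℝ) : HasDerivAt
    (fun t : ℝ => (!₂[Real.cos t, Real.sin t] : Plane)) !₂[-Real.sin t, Real.cos t] t := by
  have h : HasDerivAt (fun t : ℝ => ![Real.cos t, Real.sin t]) ![-Real.sin t, Real.cos t] t := by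
    refine hasDerivAt_pi.2 fun i => ?_
    fin_cases i
    · simpa using Real.hasDerivAt_cos t
    · simpa using Real.hasDerivAt_sin t
  exact (PiLp.hasFDerivAt_toLp (𝕜 := ℝ) 2 _).comp_hasDerivAt t h

theorem contDiff_boundaryCurve {X : Plane → Space} {k : WithTop ℕ∞} (hX : ContDiff ℝ k X) :
    ContDiff ℝ k (boundaryCurve X) := by
  refine hX.comp ?_
  rw [contDiff_euclidean]
  intro i
  fin_cases i
  · simpa using Real.contDiff_cos
  · simpa using Real.contDiff_sin

theorem deriv_boundaryCurve_ne_zero {X : Plane → Space} {r : ℕ∞} (hr : r ≠ 0)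
    (hX : IsDiskImmersion r X) (t : ℝ) : deriv (boundaryCurve X) t ≠ 0 := by
  have hd := ((hX.contDiff.differentiable (by exact_mod_cast hr)
    !₂[Real.cos t, Real.sin t]).hasFDerivAt.comp_hasDerivAt t (hasDerivAt_circle t)).deriv
  change deriv (boundaryCurve X) t = _ at hd
  rw [hd, Ne, map_eq_zero_iff _ (hX.injective_fderiv _ boundaryCurve_mem)]
  intro h0
  have h1 : Real.sin t = 0 := by simpa using congrArg (fun v : Plane => v 0) h0
  have h2 : Real.cos t = 0 := by simpa using congrArg (fun v : Plane => v 1) h0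
  simpa [h1, h2] using Real.sin_sq_add_cos_sq t

theorem curvature_const_smul {c : ℝ} (hc : 0 < c) (γ : ℝ → Space) (t : ℝ) :
    curvature (c • γ) t = curvature γ t / c := by
  have hd : ∀ s, deriv (c • γ) s = c • deriv γ s := fun s => deriv_const_smul_field c γ
  have hT : tangent (c • γ) = tangent γ := by
    ext1 s
    rw [tangent, arcDeriv, hd, norm_smul, Real.norm_of_nonneg hc.le, smul_smul, tangent, arcDeriv]
    congr 1
    field_simp
  rw [curvature, hT, curvature, arcDeriv, arcDeriv, hd, norm_smul, norm_smul, norm_smul,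
    Real.norm_of_nonneg hc.le]
  rw [norm_inv, norm_inv, norm_mul, Real.norm_of_nonneg hc.le, norm_norm]
  field_simp

end BoundaryCurve

/-- A planar disk which is critical for the energy with vanishing spontaneous curvature satisfies
the balancing formula coming from rescaling. -/
theorem integral_rescaling_eq_zero {r : ℕ∞} (hr : 4 ≤ r) (σ η ϖ β : ℝ) {p : ℕ} (hp : p ≠ 0)
    {Λ : ℝ → ℝ} {U : Set ℝ} (hU : IsOpen U) (hΛ : AnalyticOnNhd ℝ Λ U) {X : Plane → Space}
    (hX : IsDiskImmersion r X) (hplanar : IsPlanar X)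
    (hκ : ∀ t, curvature (boundaryCurve X) t ∈ U)
    (hcrit : IsCritical r (energy σ 0 p η ϖ β Λ) X) :
    ∫ t in (0 : ℝ)..(2 * Real.pi), (curvature (boundaryCurve X) t *
      deriv Λ (curvature (boundaryCurve X) t) - Λ (curvature (boundaryCurve X) t) - β) *
        ‖deriv (boundaryCurve X) t‖ = 0 := by
  obtain ⟨a, n, hn, han⟩ := hplanar
  have hγ : ContDiff ℝ 2 (boundaryCurve X) :=
    contDiff_boundaryCurve (hX.contDiff.of_le (by
      have h2 : (2 : ℕ∞) ≤ r := le_trans (by norm_num) hr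
      exact WithTop.coe_le_coe.2 h2))
  have hγ0 := deriv_boundaryCurve_ne_zero (by rintro rfl; simp at hr) hX
  set κ := curvature (boundaryCurve X) with hκdef
  set v : ℝ → ℝ := fun t => ‖deriv (boundaryCurve X) t‖ with hv
  have hκc : Continuous κ := continuous_curvature hγ hγ0
  have hvc : Continuous v := (hγ.continuous_deriv (by norm_num)).norm
  -- The dilations for which the rescaled curvature stays in the domain of analyticity of `Λ`.
  let O : Set (ℝ × ℝ) := {q | 0 < 1 + q.1} ∩ (fun q => κ q.2 / (1 + q.1)) ⁻¹' U
  have hquot : ContinuousOn (fun q : ℝ × ℝ => κ q.2 / (1 + q.1)) {q | 0 < 1 + q.1} :=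
    ContinuousOn.div (by fun_prop) (by fun_prop) fun q hq => ne_of_gt hq
  have hO : IsOpen O :=
    hquot.isOpen_inter_preimage (isOpen_lt continuous_const (by fun_prop)) hU
  have hquotO := hquot.mono (inter_subset_left : O ⊆ _)
  have hmaps : MapsTo (fun q : ℝ × ℝ => κ q.2 / (1 + q.1)) O U := fun q hq => hq.2
  have hΛO := hΛ.continuousOn.comp hquotO hmaps
  have hΛ'O := hΛ.deriv.continuousOn.comp hquotO hmaps
  have hder := hasDerivAt_setIntegral_of_continuousOn (μ := volume)
    (isCompact_Icc (a := (0 : ℝ)) (b := 2 * Real.pi)) hO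
    (fun t _ => ⟨by simp, by simpa using hκ t⟩)
    (f := fun ε t => (Λ (κ t / (1 + ε)) + β) * ((1 + ε) * v t))
    (f' := fun ε t => (deriv Λ (κ t / (1 + ε)) * ((0 * (1 + ε) - κ t * 1) / (1 + ε) ^ 2)) *
      ((1 + ε) * v t) + (Λ (κ t / (1 + ε)) + β) * (1 * v t))
    ((hΛO.add continuousOn_const).mul (by fun_prop))
    (((hΛ'O.mul (ContinuousOn.div (by fun_prop) (by fun_prop)
      fun q hq => pow_ne_zero _ (ne_of_gt hq.1))).mul (by fun_prop)).add
      ((hΛO.add continuousOn_const).mul (by fun_prop)))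
    (by
      rintro ε t ⟨h1, h2⟩
      have hid : HasDerivAt (fun e : ℝ => 1 + e) 1 ε := (hasDerivAt_id ε).const_add 1
      have hq := (hasDerivAt_const ε (κ t)).div hid (ne_of_gt h1)
      exact (((hΛ _ h2).differentiableAt.hasDerivAt.comp ε hq).add_const β).mul
        (hid.mul_const (v t)))
  have hev : (fun ε : ℝ => energy σ 0 p η ϖ β Λ (X + ε • X)) =ᶠ[𝓝 0]
      fun ε => ∫ t in Icc (0 : ℝ) (2 * Real.pi), (Λ (κ t / (1 + ε)) + β) * ((1 + ε) * v t) := by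
    filter_upwards [lt_mem_nhds (show (-1 : ℝ) < 0 by norm_num)] with ε hε
    have hε' : 0 < 1 + ε := by linarith
    have hXε : X + ε • X = (1 + ε) • X := by rw [add_smul, one_smul]
    have hbd : boundaryCurve ((1 + ε) • X) = (1 + ε) • boundaryCurve X := rfl
    rw [hXε, energy_eq_boundaryIntegral (c := (1 + ε) * inner ℝ n a) σ η ϖ β hp Λ hn,
      boundaryIntegral, intervalIntegral.integral_of_le (by positivity), integral_Icc_eq_integral_Ioc,
      hbd]
    · refine integral_congr_ae (Eventually.of_forall fun t => ?_)
      simp only [curvature_const_smul hε', hκdef, hv]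
      rw [show deriv ((1 + ε) • boundaryCurve X) t = (1 + ε) • deriv (boundaryCurve X) t from
        deriv_const_smul_field _ _, norm_smul, Real.norm_of_nonneg hε'.le]
    · intro u hu
      have := han u hu
      rw [inner_sub_right, sub_eq_zero] at this
      simp [inner_smul_right, this]
  -- Criticality is tested with the position field `V = X`.
  have h0 := (hcrit X hX.contDiff).unique (hder.congr_of_eventuallyEq hev)
  rw [intervalIntegral.integral_of_le (by positivity), ← integral_Icc_eq_integral_Ioc,
    ← neg_eq_zero, ← integral_neg]
  refine Eq.trans ?_ h0.symm
  refine integral_congr_ae (Eventually.of_forall fun t => ?_)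
  simp only [add_zero, div_one]
  ring

/-! ### Coordinate formulas for the curvatures. -/

section FundamentalForms

theorem firstForm_symm (X : Plane → Space) (u : Plane) : firstForm X u 1 0 = firstForm X u 0 1 :=
  real_inner_comm (pderiv 0 X u) (pderiv 1 X u)

theorem det_firstForm (X : Plane → Space) (u : Plane) :
    (firstForm X u).det = ‖cross (pderiv 0 X u) (pderiv 1 X u)‖ ^ 2 := by
  rw [norm_cross_sq, Matrix.det_fin_two]
  simp only [firstForm, Matrix.of_apply, real_inner_comm (pderiv 0 X u) (pderiv 1 X u)]

theorem sqrt_det_firstForm (X : Plane → Space) (u : Plane) :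
    Real.sqrt (firstForm X u).det = ‖cross (pderiv 0 X u) (pderiv 1 X u)‖ := by
  rw [det_firstForm, Real.sqrt_sq (norm_nonneg _)]

theorem secondForm_apply (X : Plane → Space) (u : Plane) (i j : Fin 2) :
    secondForm X u i j = inner ℝ (pderiv i (pderiv j X) u) (cross (pderiv 0 X u) (pderiv 1 X u)) /
      Real.sqrt (firstForm X u).det := by
  rw [secondForm, Matrix.of_apply, unitNormal, inner_smul_right, sqrt_det_firstForm]
  ring

theorem meanCurvature_eq (X : Plane → Space) (u : Plane) :
    meanCurvature X u = (firstForm X u 1 1 * secondForm X u 0 0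
      - firstForm X u 0 1 * secondForm X u 1 0 - firstForm X u 1 0 * secondForm X u 0 1
      + firstForm X u 0 0 * secondForm X u 1 1) / (2 * (firstForm X u).det) := by
  rw [meanCurvature, Matrix.inv_def, Ring.inverse_eq_inv', Matrix.adjugate_fin_two,
    Matrix.trace_fin_two]
  simp [Matrix.mul_apply, Fin.sum_univ_two]
  ring

theorem contDiff_pderiv {X : Plane → Space} {k : ℕ} (hX : ContDiff ℝ (k + 1) X) (i : Fin 2) :
    ContDiff ℝ k (pderiv i X) :=
  (hX.fderiv_right le_rfl).clm_apply contDiff_const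

end FundamentalForms

/-! ### Exact formulas for normal variations of a planar surface. -/

section NormalVariation

/-- Partial derivative of a scalar function in the `i`-th coordinate direction. -/
def scalarPderiv (i : Fin 2) (ψ : Plane → ℝ) (u : Plane) : ℝ :=
  fderiv ℝ ψ u (EuclideanSpace.single i 1)

theorem contDiff_scalarPderiv {ψ : Plane → ℝ} {k : ℕ} (hψ : ContDiff ℝ (k + 1) ψ) (i : Fin 2) :
    ContDiff ℝ k (scalarPderiv i ψ) :=
  (hψ.fderiv_right le_rfl).clm_apply contDiff_const

theorem pderiv_add_smul {X : Plane → Space} (hX : Differentiable ℝ X) {φ : Plane → ℝ}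
    (hφ : Differentiable ℝ φ) (ε : ℝ) (n : Space) (i : Fin 2) :
    pderiv i (fun u => X u + (ε * φ u) • n) =
      fun u => pderiv i X u + (ε * scalarPderiv i φ u) • n := by
  ext1 u
  have h := (hX u).hasFDerivAt.add (((hφ u).hasFDerivAt.const_mul ε).smul_const n)
  have h' : HasFDerivAt (fun u => X u + (ε * φ u) • n) _ u := h
  rw [pderiv, h'.fderiv]
  simp [pderiv, scalarPderiv]

/-- First order coefficient, in a normal variation `X + ε ψ n` of the planar surface `X`, of the
second derivatives tested against the (not normalized) normal. -/
def variationForm (X : Plane → Space) (n : Space) (ψ : Plane → ℝ) (i j : Fin 2) (u : Plane) : ℝ :=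
  scalarPderiv i (scalarPderiv j ψ) u * inner ℝ n (cross (pderiv 0 X u) (pderiv 1 X u))
    + scalarPderiv 0 ψ u * inner ℝ (pderiv i (pderiv j X) u) (cross n (pderiv 1 X u))
    + scalarPderiv 1 ψ u * inner ℝ (pderiv i (pderiv j X) u) (cross (pderiv 0 X u) n)

/-- The sum `m₁₁ b₀₀ - m₀₁ (b₁₀ + b₀₁) + m₀₀ b₁₁`, the trace of the product of `b` with the
adjugate of the symmetric matrix `m`. -/
def adjTrace (m₀₀ m₀₁ m₁₁ : ℝ) (b : Fin 2 → Fin 2 → ℝ) : ℝ :=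
  m₁₁ * b 0 0 - m₀₁ * (b 1 0 + b 0 1) + m₀₀ * b 1 1

/-- Second order coefficient of the area density squared in a normal variation. -/
def variationDet (X : Plane → Space) (ψ : Plane → ℝ) (u : Plane) : ℝ :=
  adjTrace (firstForm X u 0 0) (firstForm X u 0 1) (firstForm X u 1 1)
    fun i j => scalarPderiv i ψ u * scalarPderiv j ψ u

variable {X : Plane → Space} {n : Space} {c : ℝ} {ψ : Plane → ℝ}

theorem firstForm_normalVariation (hX : ContDiff ℝ 2 X) (hn : ‖n‖ = 1)
    (h : ∀ u ∈ Metric.ball (0 : Plane) 1, inner ℝ n (X u) = c) (hψ : ContDiff ℝ 2 ψ) (ε : ℝ)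
    {u : Plane} (hu : u ∈ Metric.ball (0 : Plane) 1) (i j : Fin 2) :
    firstForm (fun u => X u + (ε * ψ u) • n) u i j =
      firstForm X u i j + ε ^ 2 * (scalarPderiv i ψ u * scalarPderiv j ψ u) := by
  have h1 : ∀ i, inner ℝ (pderiv i X u) n = 0 := fun i => by
    rw [real_inner_comm, inner_pderiv_eq_zero h hu]
  have h2 : inner ℝ n n = (1 : ℝ) := by rw [real_inner_self_eq_norm_sq, hn, one_pow]
  simp only [firstForm, Matrix.of_apply, pderiv_add_smul (hX.differentiable (by norm_num))
    (hψ.differentiable (by norm_num)), inner_add_left, inner_add_right, inner_smul_left,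
    inner_smul_right, h1, inner_pderiv_eq_zero h hu, h2, conj_trivial]
  ring

theorem det_firstForm_normalVariation (hX : ContDiff ℝ 2 X) (hn : ‖n‖ = 1)
    (h : ∀ u ∈ Metric.ball (0 : Plane) 1, inner ℝ n (X u) = c) (hψ : ContDiff ℝ 2 ψ) (ε : ℝ)
    {u : Plane} (hu : u ∈ Metric.ball (0 : Plane) 1) :
    (firstForm (fun u => X u + (ε * ψ u) • n) u).det =
      (firstForm X u).det + ε ^ 2 * variationDet X ψ u := by
  have hsymm := firstForm_symm X u
  simp only [Matrix.det_fin_two, firstForm_normalVariation hX hn h hψ ε hu, variationDet, adjTrace,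
    hsymm]
  ring

/-- The numerator is exactly linear in `ε`: the constant term is a triple product of coplanar
vectors, and every higher term repeats `n`. -/
theorem secondForm_normalVariation (hX : ContDiff ℝ 2 X) (hn : ‖n‖ = 1)
    (h : ∀ u ∈ Metric.ball (0 : Plane) 1, inner ℝ n (X u) = c) (hψ : ContDiff ℝ 2 ψ) (ε : ℝ)
    {u : Plane} (hu : u ∈ Metric.ball (0 : Plane) 1) (i j : Fin 2) :
    secondForm (fun u => X u + (ε * ψ u) • n) u i j = ε * variationForm X n ψ i j u /
      Real.sqrt (firstForm (fun u => X u + (ε * ψ u) • n) u).det := by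
  have hn0 : n ≠ 0 := by
    rintro rfl
    simp at hn
  have hdX : ∀ i, Differentiable ℝ (pderiv i X) := fun i =>
    (contDiff_pderiv (k := 1) (by simpa [one_add_one_eq_two] using hX) i).differentiable
      (by norm_num)
  have hdψ : ∀ i, Differentiable ℝ (scalarPderiv i ψ) := fun i =>
    (contDiff_scalarPderiv (k := 1) (by simpa [one_add_one_eq_two] using hψ) i).differentiable
      (by norm_num)
  rw [secondForm_apply]
  congr 1
  rw [pderiv_add_smul (hX.differentiable (by norm_num)) (hψ.differentiable (by norm_num)),
    pderiv_add_smul (hX.differentiable (by norm_num)) (hψ.differentiable (by norm_num)),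
    pderiv_add_smul (hX.differentiable (by norm_num)) (hψ.differentiable (by norm_num)),
    pderiv_add_smul (hdX j) (hdψ j)]
  have h0 := inner_cross_eq_zero hn0 (inner_pderiv_pderiv_eq_zero h hu i j)
    (inner_pderiv_eq_zero h hu 0) (inner_pderiv_eq_zero h hu 1)
  simp only [variationForm]
  generalize pderiv i (pderiv j X) u = x at *
  generalize pderiv 0 X u = a at *
  generalize pderiv 1 X u = b at *
  simp only [inner_space_eq, cross_zero_apply, cross_one_apply, cross_two_apply, PiLp.add_apply,
    PiLp.smul_apply, smul_eq_mul] at *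
  linear_combination h0

theorem meanCurvature_normalVariation (hX : ContDiff ℝ 2 X) (hn : ‖n‖ = 1)
    (h : ∀ u ∈ Metric.ball (0 : Plane) 1, inner ℝ n (X u) = c) (hψ : ContDiff ℝ 2 ψ) (ε : ℝ)
    {u : Plane} (hu : u ∈ Metric.ball (0 : Plane) 1) :
    meanCurvature (fun u => X u + (ε * ψ u) • n) u =
      ε * (adjTrace (firstForm X u 0 0) (firstForm X u 0 1) (firstForm X u 1 1)
          (fun i j => variationForm X n ψ i j u)
        + ε ^ 2 * adjTrace (scalarPderiv 0 ψ u * scalarPderiv 0 ψ u)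
          (scalarPderiv 0 ψ u * scalarPderiv 1 ψ u) (scalarPderiv 1 ψ u * scalarPderiv 1 ψ u)
          (fun i j => variationForm X n ψ i j u))
      / (2 * ((firstForm X u).det + ε ^ 2 * variationDet X ψ u) *
        Real.sqrt ((firstForm X u).det + ε ^ 2 * variationDet X ψ u)) := by
  have hsymm := firstForm_symm X u
  rw [meanCurvature_eq]
  simp only [secondForm_normalVariation hX hn h hψ ε hu,
    det_firstForm_normalVariation hX hn h hψ ε hu, firstForm_normalVariation hX hn h hψ ε hu,
    adjTrace, hsymm]
  rw [mul_comm (2 : ℝ), mul_assoc, mul_comm _ (Real.sqrt _), ← mul_assoc]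
  field_simp
  ring

theorem gaussCurvature_normalVariation (hX : ContDiff ℝ 2 X) (hn : ‖n‖ = 1)
    (h : ∀ u ∈ Metric.ball (0 : Plane) 1, inner ℝ n (X u) = c) (hψ : ContDiff ℝ 2 ψ) (ε : ℝ)
    {u : Plane} (hu : u ∈ Metric.ball (0 : Plane) 1) :
    gaussCurvature (fun u => X u + (ε * ψ u) • n) u =
      ε ^ 2 * (variationForm X n ψ 0 0 u * variationForm X n ψ 1 1 u
        - variationForm X n ψ 0 1 u * variationForm X n ψ 1 0 u)
      / ((firstForm X u).det + ε ^ 2 * variationDet X ψ u) ^ 2 := by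
  have hD := det_firstForm_normalVariation hX hn h hψ ε hu
  have hD0 : 0 ≤ (firstForm X u).det + ε ^ 2 * variationDet X ψ u := by
    rw [← hD, det_firstForm]
    positivity
  rw [gaussCurvature, Matrix.det_fin_two]
  simp only [secondForm_normalVariation hX hn h hψ ε hu, hD, div_mul_div_comm,
    Real.mul_self_sqrt hD0]
  rw [← sub_div, div_div, ← sq]
  ring

end NormalVariation

/-! ### First variations of the surface integrals. -/

section DiskIntegrals

variable {d₀ d₂ t₀ t₂ b : Plane → ℝ}

theorem isCompact_disk : IsCompact disk := isCompact_closedBall _ _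

/-- At `ε = 0` the quotient vanishes with derivative `t₀ / (2 d₀^(3/2))`, and the density `√d₀` is
stationary because it depends on `ε²`; their product leaves `t₀ / (2 d₀)`. -/
theorem hasDerivAt_bending (hd₀ : Continuous d₀) (hd₂ : Continuous d₂) (ht₀ : Continuous t₀)
    (ht₂ : Continuous t₂) (hpos : ∀ u ∈ disk, 0 < d₀ u) (c₀ : ℝ) (p : ℕ) :
    HasDerivAt (fun ε : ℝ => ∫ u in disk, (ε * (t₀ u + ε ^ 2 * t₂ u) /
        (2 * (d₀ u + ε ^ 2 * d₂ u) * Real.sqrt (d₀ u + ε ^ 2 * d₂ u)) - c₀) ^ p *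
          Real.sqrt (d₀ u + ε ^ 2 * d₂ u))
      (p * (-c₀) ^ (p - 1) / 2 * ∫ u in disk, t₀ u / d₀ u) 0 := by
  let O : Set (ℝ × Plane) := {q | 0 < d₀ q.2 + q.1 ^ 2 * d₂ q.2}
  have hO : IsOpen O := isOpen_lt continuous_const (by fun_prop)
  have hs : ∀ q ∈ O, 2 * (d₀ q.2 + q.1 ^ 2 * d₂ q.2) *
      Real.sqrt (d₀ q.2 + q.1 ^ 2 * d₂ q.2) ≠ 0 := fun q hq =>
    mul_ne_zero (mul_ne_zero two_ne_zero (ne_of_gt hq)) (Real.sqrt_ne_zero'.2 hq)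
  have hs' : ∀ q ∈ O, 2 * Real.sqrt (d₀ q.2 + q.1 ^ 2 * d₂ q.2) ≠ 0 := fun q hq =>
    mul_ne_zero two_ne_zero (Real.sqrt_ne_zero'.2 hq)
  have hA : ContinuousOn (fun q : ℝ × Plane => q.1 * (t₀ q.2 + q.1 ^ 2 * t₂ q.2) /
      (2 * (d₀ q.2 + q.1 ^ 2 * d₂ q.2) * Real.sqrt (d₀ q.2 + q.1 ^ 2 * d₂ q.2)) - c₀) O :=
    (ContinuousOn.div (by fun_prop) (by fun_prop) hs).sub continuousOn_const
  have hS : ContinuousOn (fun q : ℝ × Plane =>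
      (2 * q.1 * d₂ q.2) / (2 * Real.sqrt (d₀ q.2 + q.1 ^ 2 * d₂ q.2))) O :=
    ContinuousOn.div (by fun_prop) (by fun_prop) hs'
  have key := hasDerivAt_setIntegral_of_continuousOn (μ := volume) isCompact_disk hO
    (fun u hu => by simpa [O] using hpos u hu)
    (f := fun ε u => (ε * (t₀ u + ε ^ 2 * t₂ u) /
        (2 * (d₀ u + ε ^ 2 * d₂ u) * Real.sqrt (d₀ u + ε ^ 2 * d₂ u)) - c₀) ^ p *
          Real.sqrt (d₀ u + ε ^ 2 * d₂ u))
    (f' := fun ε u =>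
      (p * (ε * (t₀ u + ε ^ 2 * t₂ u) /
        (2 * (d₀ u + ε ^ 2 * d₂ u) * Real.sqrt (d₀ u + ε ^ 2 * d₂ u)) - c₀) ^ (p - 1) *
        (((1 * (t₀ u + ε ^ 2 * t₂ u) + ε * (2 * ε * t₂ u)) *
          (2 * (d₀ u + ε ^ 2 * d₂ u) * Real.sqrt (d₀ u + ε ^ 2 * d₂ u)) -
          ε * (t₀ u + ε ^ 2 * t₂ u) * (2 * (2 * ε * d₂ u) * Real.sqrt (d₀ u + ε ^ 2 * d₂ u) +
            2 * (d₀ u + ε ^ 2 * d₂ u) *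
              ((2 * ε * d₂ u) / (2 * Real.sqrt (d₀ u + ε ^ 2 * d₂ u))))) /
          (2 * (d₀ u + ε ^ 2 * d₂ u) * Real.sqrt (d₀ u + ε ^ 2 * d₂ u)) ^ 2)) *
        Real.sqrt (d₀ u + ε ^ 2 * d₂ u) +
      (ε * (t₀ u + ε ^ 2 * t₂ u) /
        (2 * (d₀ u + ε ^ 2 * d₂ u) * Real.sqrt (d₀ u + ε ^ 2 * d₂ u)) - c₀) ^ p *
        ((2 * ε * d₂ u) / (2 * Real.sqrt (d₀ u + ε ^ 2 * d₂ u))))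
    ((hA.pow p).mul (by fun_prop))
    ((((continuousOn_const.mul (hA.pow (p - 1))).mul (ContinuousOn.div (ContinuousOn.sub
      (by fun_prop) (ContinuousOn.mul (by fun_prop) (ContinuousOn.add (by fun_prop)
        (ContinuousOn.mul (by fun_prop) hS)))) (by fun_prop)
        fun q hq => pow_ne_zero _ (hs q hq))).mul (by fun_prop)).add ((hA.pow p).mul hS))
    (by
      intro ε u hq
      have hsq : HasDerivAt (fun e : ℝ => e ^ 2) (2 * ε) ε := by simpa using hasDerivAt_pow 2 ε
      have hD := (hsq.mul_const (d₂ u)).const_add (d₀ u)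
      have hT := (hasDerivAt_id ε).mul ((hsq.mul_const (t₂ u)).const_add (t₀ u))
      have hR := hD.sqrt (ne_of_gt hq)
      exact (((hT.div ((hD.const_mul 2).mul hR) (hs _ hq)).sub_const c₀).pow p).mul hR)
  refine key.congr_deriv ?_
  rw [← integral_const_mul]
  refine setIntegral_congr_fun isCompact_disk.measurableSet fun u hu => ?_
  have h1 := hpos u hu
  have h2 : 0 < Real.sqrt (d₀ u) := Real.sqrt_pos.2 h1
  simp
  field_simp

theorem hasDerivAt_total_curvature (hd₀ : Continuous d₀) (hd₂ : Continuous d₂)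
    (hb : Continuous b) (hpos : ∀ u ∈ disk, 0 < d₀ u) :
    HasDerivAt (fun ε : ℝ => ∫ u in disk, ε ^ 2 * b u / (d₀ u + ε ^ 2 * d₂ u) ^ 2 *
          Real.sqrt (d₀ u + ε ^ 2 * d₂ u)) 0 0 := by
  let O : Set (ℝ × Plane) := {q | 0 < d₀ q.2 + q.1 ^ 2 * d₂ q.2}
  have hO : IsOpen O := isOpen_lt continuous_const (by fun_prop)
  have hs' : ∀ q ∈ O, 2 * Real.sqrt (d₀ q.2 + q.1 ^ 2 * d₂ q.2) ≠ 0 := fun q hq =>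
    mul_ne_zero two_ne_zero (Real.sqrt_ne_zero'.2 hq)
  have hs : ∀ q ∈ O, (d₀ q.2 + q.1 ^ 2 * d₂ q.2) ^ 2 ≠ 0 := fun q hq =>
    pow_ne_zero _ (ne_of_gt hq)
  have hS : ContinuousOn (fun q : ℝ × Plane =>
      (2 * q.1 * d₂ q.2) / (2 * Real.sqrt (d₀ q.2 + q.1 ^ 2 * d₂ q.2))) O :=
    ContinuousOn.div (by fun_prop) (by fun_prop) hs'
  have key := hasDerivAt_setIntegral_of_continuousOn (μ := volume) isCompact_disk hO
    (fun u hu => by simpa [O] using hpos u hu)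
    (f := fun ε u => ε ^ 2 * b u / (d₀ u + ε ^ 2 * d₂ u) ^ 2 *
          Real.sqrt (d₀ u + ε ^ 2 * d₂ u))
    (f' := fun ε u => ((2 * ε * b u * (d₀ u + ε ^ 2 * d₂ u) ^ 2 - ε ^ 2 * b u *
      (2 * (d₀ u + ε ^ 2 * d₂ u) * (2 * ε * d₂ u))) / ((d₀ u + ε ^ 2 * d₂ u) ^ 2) ^ 2) *
        Real.sqrt (d₀ u + ε ^ 2 * d₂ u) + ε ^ 2 * b u / (d₀ u + ε ^ 2 * d₂ u) ^ 2 *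
        ((2 * ε * d₂ u) / (2 * Real.sqrt (d₀ u + ε ^ 2 * d₂ u))))
    ((ContinuousOn.div (by fun_prop) (by fun_prop) hs).mul (by fun_prop))
    (((ContinuousOn.div (by fun_prop) (by fun_prop) fun q hq => pow_ne_zero _ (hs q hq)).mul
      (by fun_prop)).add ((ContinuousOn.div (by fun_prop) (by fun_prop) hs).mul hS))
    (by
      intro ε u hq
      have hsq : HasDerivAt (fun e : ℝ => e ^ 2) (2 * ε) ε := by simpa using hasDerivAt_pow 2 ε
      have hD := (hsq.mul_const (d₂ u)).const_add (d₀ u)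
      have hR := hD.sqrt (ne_of_gt hq)
      have hD2 : HasDerivAt (fun e : ℝ => (d₀ u + e ^ 2 * d₂ u) ^ 2)
        (2 * (d₀ u + ε ^ 2 * d₂ u) * (2 * ε * d₂ u)) ε := by simpa using hD.fun_pow 2
      exact ((hsq.mul_const (b u)).div hD2 (hs _ hq)).mul hR)
  exact key.congr_deriv (by simp)

theorem integral_disk_ne_zero {f : Plane → ℝ} (hf : ContinuousOn f disk)
    (hneg : ∀ u ∈ disk, u ≠ 0 → f u < 0) : ∫ u in disk, f u ≠ 0 := by
  have h0 : ∀ᵐ u : Plane, u ≠ 0 := Measure.ae_ne volume 0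
  have hpos : 0 < ∫ u in disk, -f u := by
    rw [setIntegral_pos_iff_support_of_nonneg_ae]
    · refine lt_of_lt_of_le ?_ (measure_mono (?_ : Metric.ball (0 : Plane) 1 \ {0} ⊆ _))
      · rw [measure_sdiff_null (by simp)]
        exact Metric.measure_ball_pos _ _ one_pos
      · rintro u ⟨hu, hu0⟩
        have hu' : u ∈ disk := Metric.ball_subset_closedBall hu
        exact ⟨by simpa using (hneg u hu' hu0).ne, hu'⟩
    · filter_upwards [ae_restrict_mem isCompact_disk.measurableSet, ae_restrict_of_ae h0]
        with u hu hu0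
      simpa using (hneg u hu hu0).le
    · exact hf.neg.integrableOn_compact isCompact_disk
  rw [integral_neg] at hpos
  linarith

end DiskIntegrals

/-! ### A radial barrier for the linearized mean curvature. -/

section Profile

/-- The radial profile `1 - |u| ^ (2 k)`, which vanishes on the boundary of the disk. -/
def radialProfile (k : ℕ) (u : Plane) : ℝ := 1 - (u 0 ^ 2 + u 1 ^ 2) ^ k

theorem contDiff_radialProfile (k : ℕ) {r : WithTop ℕ∞} : ContDiff ℝ r (radialProfile k) := by
  unfold radialProfile
  fun_prop

theorem hasFDerivAt_sq_radius (u : Plane) : HasFDerivAt (fun u : Plane => u 0 ^ 2 + u 1 ^ 2)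
    ((2 * u 0) • (EuclideanSpace.proj 0 : Plane →L[ℝ] ℝ) +
      (2 * u 1) • (EuclideanSpace.proj 1 : Plane →L[ℝ] ℝ)) u := by
  have h : ∀ i : Fin 2, HasFDerivAt (fun u : Plane => u i)
      (EuclideanSpace.proj i : Plane →L[ℝ] ℝ) u := fun i =>
    (EuclideanSpace.proj i : Plane →L[ℝ] ℝ).hasFDerivAt
  have hsq : ∀ i : Fin 2, HasFDerivAt (fun u : Plane => u i ^ 2)
      ((2 * u i) • (EuclideanSpace.proj i : Plane →L[ℝ] ℝ)) u := fun i => by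
    have h2 := (hasDerivAt_pow 2 (u i)).comp_hasFDerivAt u (h i)
    change HasFDerivAt (fun u : Plane => u i ^ 2) _ u at h2
    simpa using h2
  exact (hsq 0).add (hsq 1)

/-- The exponent is written `m + 2` so that two derivatives leave a genuine power `m`, with no
truncated subtraction. -/
theorem scalarPderiv_radialProfile (m : ℕ) (i : Fin 2) :
    scalarPderiv i (radialProfile (m + 2)) =
      fun u : Plane => -((m + 2) * (u 0 ^ 2 + u 1 ^ 2) ^ (m + 1)) * (2 * u i) := by
  ext1 u
  have h : HasFDerivAt (radialProfile (m + 2)) _ u :=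
    ((hasDerivAt_pow (m + 2) _).comp_hasFDerivAt u (hasFDerivAt_sq_radius u)).const_sub 1
  rw [scalarPderiv, h.fderiv]
  fin_cases i <;> simp

theorem scalarPderiv_scalarPderiv_radialProfile (m : ℕ) (i j : Fin 2) (u : Plane) :
    scalarPderiv i (scalarPderiv j (radialProfile (m + 2))) u =
      -((m + 2) * (u 0 ^ 2 + u 1 ^ 2) ^ m) * (4 * (m + 1) * (u i * u j) +
        (u 0 ^ 2 + u 1 ^ 2) * (if i = j then 2 else 0)) := by
  have hj : HasFDerivAt (fun u : Plane => u j) (EuclideanSpace.proj j : Plane →L[ℝ] ℝ) u :=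
    (EuclideanSpace.proj j : Plane →L[ℝ] ℝ).hasFDerivAt
  have hq : HasFDerivAt (fun u : Plane => -((m + 2) * (u 0 ^ 2 + u 1 ^ 2) ^ (m + 1) : ℝ)) _ u :=
    (((hasDerivAt_pow (m + 1) _).comp_hasFDerivAt u (hasFDerivAt_sq_radius u)).const_mul
      ((m : ℝ) + 2)).neg
  rw [scalarPderiv_radialProfile, scalarPderiv, (hq.fun_mul (hj.const_mul 2)).fderiv]
  fin_cases i <;> fin_cases j <;> simp <;> ring

theorem radialProfile_circle {k : ℕ} (t : ℝ) :
    radialProfile k !₂[Real.cos t, Real.sin t] = 0 := by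
  simp [radialProfile]

/-- The terms of lower order in the linearized mean curvature of a radial normal variation. -/
def lowerOrderForm (X : Plane → Space) (n : Space) (i j : Fin 2) (u : Plane) : ℝ :=
  (if i = j then 2 else 0) * inner ℝ n (cross (pderiv 0 X u) (pderiv 1 X u))
    + 2 * u 0 * inner ℝ (pderiv i (pderiv j X) u) (cross n (pderiv 1 X u))
    + 2 * u 1 * inner ℝ (pderiv i (pderiv j X) u) (cross (pderiv 0 X u) n)

theorem variationForm_radialProfile (X : Plane → Space) (n : Space) (m : ℕ) (i j : Fin 2)
    (u : Plane) : variationForm X n (radialProfile (m + 2)) i j u =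
      -((m + 2) * (u 0 ^ 2 + u 1 ^ 2) ^ m) * (4 * (m + 1) * (u i * u j) *
        inner ℝ n (cross (pderiv 0 X u) (pderiv 1 X u))
          + (u 0 ^ 2 + u 1 ^ 2) * lowerOrderForm X n i j u) := by
  rw [variationForm, scalarPderiv_scalarPderiv_radialProfile, scalarPderiv_radialProfile,
    scalarPderiv_radialProfile, lowerOrderForm]
  ring

variable {X : Plane → Space} {n : Space}

theorem continuous_pderiv (hX : ContDiff ℝ 2 X) (i : Fin 2) : Continuous (pderiv i X) :=
  (contDiff_pderiv (k := 1) (by simpa [one_add_one_eq_two] using hX) i).continuous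

theorem continuous_pderiv_pderiv (hX : ContDiff ℝ 2 X) (i j : Fin 2) :
    Continuous (pderiv i (pderiv j X)) :=
  (contDiff_pderiv (k := 0) (by
    simpa using contDiff_pderiv (k := 1) (by simpa [one_add_one_eq_two] using hX) j) i).continuous

theorem continuous_firstForm (hX : ContDiff ℝ 2 X) (i j : Fin 2) :
    Continuous fun u => firstForm X u i j :=
  (continuous_pderiv hX i).inner (continuous_pderiv hX j)

theorem continuous_inner_cross (hX : ContDiff ℝ 2 X) (n : Space) :
    Continuous fun u => inner ℝ n (cross (pderiv 0 X u) (pderiv 1 X u)) :=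
  continuous_const.inner (continuous_cross (continuous_pderiv hX 0) (continuous_pderiv hX 1))

theorem continuous_lowerOrderForm (hX : ContDiff ℝ 2 X) (n : Space) (i j : Fin 2) :
    Continuous (lowerOrderForm X n i j) := by
  have h0 := continuous_pderiv hX 0
  have h1 := continuous_pderiv hX 1
  have h2 := continuous_pderiv_pderiv hX i j
  have h3 := continuous_inner_cross hX n
  unfold lowerOrderForm
  fun_prop

theorem continuous_variationForm (hX : ContDiff ℝ 2 X) (n : Space) {ψ : Plane → ℝ}
    (hψ : ContDiff ℝ 2 ψ) (i j : Fin 2) : Continuous (variationForm X n ψ i j) := by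
  have h0 := continuous_pderiv hX 0
  have h1 := continuous_pderiv hX 1
  have h2 := continuous_pderiv_pderiv hX i j
  have h3 := continuous_inner_cross hX n
  have hc : ∀ i, ContDiff ℝ (1 : ℕ) (scalarPderiv i ψ) :=
    contDiff_scalarPderiv (by simpa [one_add_one_eq_two] using hψ)
  have h4 := (hc 0).continuous
  have h5 := (hc 1).continuous
  have h6 := (contDiff_scalarPderiv (k := 0) (by simpa using hc j) i).continuous
  unfold variationForm
  fun_prop

/-- As for a Hopf barrier: the Hessian of `|u|^(2k)` gives a positive definite term whose weight
grows with `k`, while the lower-order terms, after removing the common factor, stay bounded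
independently of `k`. -/
theorem exists_adjTrace_neg (hX : ContDiff ℝ 2 X)
    (hJ : ∀ u ∈ disk, 0 < inner ℝ n (cross (pderiv 0 X u) (pderiv 1 X u))) :
    ∃ k, ∀ u ∈ disk, u ≠ 0 →
      adjTrace (firstForm X u 0 0) (firstForm X u 0 1) (firstForm X u 1 1)
        (fun i j => variationForm X n (radialProfile k) i j u) < 0 := by
  have hg := continuous_firstForm hX
  have hR : Continuous fun u => adjTrace (firstForm X u 0 0) (firstForm X u 0 1) (firstForm X u 1 1)
      (fun i j => lowerOrderForm X n i j u) := by
    have h00 := hg 0 0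
    have h01 := hg 0 1
    have h11 := hg 1 1
    have hl00 := continuous_lowerOrderForm hX n 0 0
    have hl01 := continuous_lowerOrderForm hX n 0 1
    have hl10 := continuous_lowerOrderForm hX n 1 0
    have hl11 := continuous_lowerOrderForm hX n 1 1
    unfold adjTrace
    fun_prop
  have hdet : ∀ u ∈ disk,
      0 < firstForm X u 0 0 * firstForm X u 1 1 - firstForm X u 0 1 * firstForm X u 0 1 := by
    intro u hu
    have h1 := det_firstForm X u
    rw [Matrix.det_fin_two, firstForm_symm] at h1
    rw [h1, sq_pos_iff, norm_ne_zero_iff]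
    intro h0
    have := hJ u hu
    rw [h0, inner_zero_right] at this
    exact this.false
  have htr : ∀ u ∈ disk, 0 < firstForm X u 0 0 + firstForm X u 1 1 := by
    intro u hu
    have h0 : 0 ≤ firstForm X u 0 0 := real_inner_self_nonneg (x := pderiv 0 X u)
    have h1 : 0 ≤ firstForm X u 1 1 := real_inner_self_nonneg (x := pderiv 1 X u)
    by_contra hle
    have h0' : firstForm X u 0 0 = 0 := by linarith
    have := hdet u hu
    rw [h0'] at this
    nlinarith [sq_nonneg (firstForm X u 0 1)]
  have hell : ContinuousOn (fun u => inner ℝ n (cross (pderiv 0 X u) (pderiv 1 X u)) *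
      ((firstForm X u 0 0 * firstForm X u 1 1 - firstForm X u 0 1 * firstForm X u 0 1) /
        (firstForm X u 0 0 + firstForm X u 1 1))) disk :=
    (continuous_inner_cross hX n).continuousOn.mul (ContinuousOn.div
      (((hg 0 0).mul (hg 1 1)).sub ((hg 0 1).mul (hg 0 1))).continuousOn
      ((hg 0 0).add (hg 1 1)).continuousOn fun u hu => (htr u hu).ne')
  obtain ⟨w, hw, hmin⟩ := isCompact_disk.exists_isMinOn
    ⟨0, by simp [disk]⟩ hell
  obtain ⟨M, hM⟩ := isCompact_disk.exists_bound_of_continuousOn hR.continuousOn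
  set e := inner ℝ n (cross (pderiv 0 X w) (pderiv 1 X w)) *
      ((firstForm X w 0 0 * firstForm X w 1 1 - firstForm X w 0 1 * firstForm X w 0 1) /
        (firstForm X w 0 0 + firstForm X w 1 1)) with he
  have hepos : 0 < e := mul_pos (hJ w hw) (div_pos (hdet w hw) (htr w hw))
  -- `e` bounds the ellipticity from below on the disk and `M` bounds the lower-order terms, so `m e
  -- > M` lets the leading term win.
  obtain ⟨m, hm⟩ := exists_nat_gt (M / e)
  rw [div_lt_iff₀ hepos] at hm
  refine ⟨m + 2, fun u hu hu0 => ?_⟩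
  have hmin' := isMinOn_iff.1 hmin u hu
  have hMu := neg_le_of_abs_le (hM u hu)
  have hq : 0 < u 0 ^ 2 + u 1 ^ 2 := by
    have h := norm_pos_iff.2 hu0
    rw [EuclideanSpace.norm_eq, Real.sqrt_pos, Fin.sum_univ_two] at h
    simpa using h
  have hJu := hJ u hu
  have hdu := hdet u hu
  have htu := htr u hu
  simp only [adjTrace, variationForm_radialProfile] at hMu ⊢
  generalize inner ℝ n (cross (pderiv 0 X u) (pderiv 1 X u)) = J at *
  generalize firstForm X u 0 0 = a at *
  generalize firstForm X u 0 1 = b at *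
  generalize firstForm X u 1 1 = d at *
  -- The least eigenvalue of a positive definite 2×2 matrix is at least determinant over trace; the
  -- defect, times the trace, is the sum of the two squares supplied.
  have hadj : (a * d - b * b) / (a + d) * (u 0 ^ 2 + u 1 ^ 2) ≤
      d * (u 0 * u 0) - b * (u 1 * u 0 + u 0 * u 1) + a * (u 1 * u 1) := by
    rw [div_mul_eq_mul_div, div_le_iff₀ htu]
    nlinarith [sq_nonneg (d * u 0 - b * u 1), sq_nonneg (a * u 1 - b * u 0)]
  have hJadj := mul_le_mul_of_nonneg_left hadj hJu.le
  have hR' := mul_le_mul_of_nonneg_left hMu hq.le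
  have he' := mul_le_mul_of_nonneg_right hmin' hq.le
  have hfac : 0 < ((m : ℝ) + 2) * (u 0 ^ 2 + u 1 ^ 2) ^ m := by positivity
  have h1 : e * (u 0 ^ 2 + u 1 ^ 2) ≤
      J * (d * (u 0 * u 0) - b * (u 1 * u 0 + u 0 * u 1) + a * (u 1 * u 1)) := by
    linarith
  have h2 := mul_le_mul_of_nonneg_left h1 (by positivity : (0 : ℝ) ≤ 4 * (m + 1))
  have h3 : 0 < (4 * ((m : ℝ) + 1) * e - M) * (u 0 ^ 2 + u 1 ^ 2) := by
    refine mul_pos ?_ hq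
    nlinarith [mul_nonneg (Nat.cast_nonneg m : (0 : ℝ) ≤ m) hepos.le]
  have h4 := mul_pos hfac (show 0 < 4 * ((m : ℝ) + 1) * (J *
    (d * (u 0 * u 0) - b * (u 1 * u 0 + u 0 * u 1) + a * (u 1 * u 1))) + (u 0 ^ 2 + u 1 ^ 2) *
      (d * lowerOrderForm X n 0 0 u - b * (lowerOrderForm X n 1 0 u + lowerOrderForm X n 0 1 u)
        + a * lowerOrderForm X n 1 1 u) by linarith)
  linarith

end Profile

/-! ### Vanishing of the spontaneous curvature. -/

section Criticality

/-- The Jacobian along `n` is continuous and, by immersivity, never zero on the disk, so it has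
constant sign by connectedness; `n` is oriented by its sign at the origin. -/
theorem exists_unit_normal {r : ℕ∞} (hr : 4 ≤ r) {X : Plane → Space} (hX : IsDiskImmersion r X)
    (hplanar : IsPlanar X) : ∃ n : Space, ‖n‖ = 1 ∧ (∃ c, ∀ u ∈ disk, inner ℝ n (X u) = c) ∧
      ∀ u ∈ disk, 0 < inner ℝ n (cross (pderiv 0 X u) (pderiv 1 X u)) := by
  have hX2 : ContDiff ℝ 2 X := hX.contDiff.of_le (by
    have h2 : (2 : ℕ∞) ≤ r := le_trans (by norm_num) hr
    exact WithTop.coe_le_coe.2 h2)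
  have main : ∀ n : Space, ‖n‖ = 1 → (∃ c, ∀ u ∈ disk, inner ℝ n (X u) = c) →
      0 ≤ inner ℝ n (cross (pderiv 0 X 0) (pderiv 1 X 0)) →
      ∀ u ∈ disk, 0 < inner ℝ n (cross (pderiv 0 X u) (pderiv 1 X u)) := by
    rintro n hn ⟨c, hc⟩ h0 u hu
    -- Orthogonality passes from the open ball to its closure by continuity of the first
    -- derivatives.
    have hperp : ∀ i, ∀ u ∈ disk, inner ℝ n (pderiv i X u) = 0 := by
      intro i u hu
      have hcl : IsClosed {u | inner ℝ n (pderiv i X u) = 0} :=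
        isClosed_eq (continuous_const.inner (continuous_pderiv hX2 i)) continuous_const
      refine hcl.closure_subset_iff.2 (fun w hw => ?_)
        (by rwa [closure_ball (0 : Plane) one_ne_zero] : u ∈ closure (Metric.ball (0 : Plane) 1))
      exact inner_pderiv_eq_zero (fun w hw => hc w (Metric.ball_subset_closedBall hw)) hw i
    have hne : ∀ u ∈ disk, inner ℝ n (cross (pderiv 0 X u) (pderiv 1 X u)) ≠ 0 := by
      intro u hu hz
      have hsq := inner_cross_sq (hperp 0 u hu) (hperp 1 u hu)
      rw [hz, hn] at hsq
      refine cross_ne_zero (fun x y hxy => ?_) (norm_eq_zero.1 (by simpa using hsq.symm))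
      have h1 : fderiv ℝ X u (x • EuclideanSpace.single 0 1 + y • EuclideanSpace.single 1 1) = 0 := by
        rw [map_add, map_smul, map_smul]
        exact hxy
      rw [map_eq_zero_iff _ (hX.injective_fderiv u hu)] at h1
      exact ⟨by simpa using congrArg (fun v : Plane => v 0) h1,
        by simpa using congrArg (fun v : Plane => v 1) h1⟩
    by_contra hle
    obtain ⟨w, hw, hw0⟩ := ((convex_closedBall (0 : Plane) 1).isPreconnected).intermediate_value
      hu (by simp : (0 : Plane) ∈ Metric.closedBall 0 1) (continuous_inner_cross hX2 n).continuousOn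
      ⟨not_lt.1 hle, h0⟩
    exact hne w hw hw0
  obtain ⟨a, n, hn, han⟩ := hplanar
  have hn1 : ‖‖n‖⁻¹ • n‖ = 1 := norm_smul_inv_norm hn
  have hc : ∀ u ∈ disk, inner ℝ (‖n‖⁻¹ • n) (X u) = inner ℝ (‖n‖⁻¹ • n) a := fun u hu => by
    have := han u hu
    rw [inner_sub_right, sub_eq_zero] at this
    rw [inner_smul_left, inner_smul_left, this]
  rcases le_total 0 (inner ℝ (‖n‖⁻¹ • n) (cross (pderiv 0 X 0) (pderiv 1 X 0))) with h | h
  · exact ⟨_, hn1, ⟨_, hc⟩, main _ hn1 ⟨_, hc⟩ h⟩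
  · have hn1' : ‖-(‖n‖⁻¹ • n)‖ = 1 := by rw [norm_neg, hn1]
    have hc' : ∀ u ∈ disk, inner ℝ (-(‖n‖⁻¹ • n)) (X u) = -inner ℝ (‖n‖⁻¹ • n) a := fun u hu => by
      rw [inner_neg_left, hc u hu]
    exact ⟨_, hn1', ⟨_, hc'⟩, main _ hn1' ⟨_, hc'⟩ (by rw [inner_neg_left]; linarith)⟩

/-- A planar disk can only be critical if the spontaneous curvature vanishes. -/
theorem spontaneousCurvature_eq_zero {r : ℕ∞} (hr : 4 ≤ r) {σ c₀ η ϖ β : ℝ} (hσ : 0 < σ) {p : ℕ}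
    (hp : p ≠ 0) {Λ : ℝ → ℝ} {X : Plane → Space} (hX : IsDiskImmersion r X)
    (hplanar : IsPlanar X) (hcrit : IsCritical r (energy σ c₀ p η ϖ β Λ) X) : c₀ = 0 := by
  have hX2 : ContDiff ℝ 2 X := hX.contDiff.of_le (by
    have h2 : (2 : ℕ∞) ≤ r := le_trans (by norm_num) hr
    exact WithTop.coe_le_coe.2 h2)
  obtain ⟨n, hn, ⟨c, hc⟩, hJ⟩ := exists_unit_normal hr hX hplanar
  have hcb : ∀ u ∈ Metric.ball (0 : Plane) 1, inner ℝ n (X u) = c := fun u hu =>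
    hc u (Metric.ball_subset_closedBall hu)
  obtain ⟨k, hk⟩ := exists_adjTrace_neg hX2 hJ
  set ψ := radialProfile k with hψdef
  have hψ : ContDiff ℝ 2 ψ := contDiff_radialProfile k
  have hψ1 : ∀ i, Continuous (scalarPderiv i ψ) := fun i =>
    (contDiff_scalarPderiv (k := 1) (by simpa [one_add_one_eq_two] using hψ) i).continuous
  have hg := continuous_firstForm hX2
  have hB := continuous_variationForm hX2 n hψ
  have hadj : ∀ {a b d : Plane → ℝ} {f : Fin 2 → Fin 2 → Plane → ℝ}, Continuous a → Continuous b →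
      Continuous d → (∀ i j, Continuous (f i j)) →
      Continuous fun u => adjTrace (a u) (b u) (d u) (fun i j => f i j u) := by
    intro a b d f ha hb hd hf
    have h00 := hf 0 0
    have h01 := hf 0 1
    have h10 := hf 1 0
    have h11 := hf 1 1
    unfold adjTrace
    fun_prop
  have hd₀ : Continuous fun u => (firstForm X u).det := by
    simp only [Matrix.det_fin_two]
    exact ((hg 0 0).mul (hg 1 1)).sub ((hg 0 1).mul (hg 1 0))
  have hd₂ : Continuous (variationDet X ψ) :=
    hadj (hg 0 0) (hg 0 1) (hg 1 1) fun i j => (hψ1 i).mul (hψ1 j)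
  have ht₀ := hadj (hg 0 0) (hg 0 1) (hg 1 1) hB
  have ht₂ := hadj ((hψ1 0).mul (hψ1 0)) ((hψ1 0).mul (hψ1 1)) ((hψ1 1).mul (hψ1 1)) hB
  have hb : Continuous fun u => variationForm X n ψ 0 0 u * variationForm X n ψ 1 1 u
      - variationForm X n ψ 0 1 u * variationForm X n ψ 1 0 u :=
    ((hB 0 0).mul (hB 1 1)).sub ((hB 0 1).mul (hB 1 0))
  have hpos : ∀ u ∈ disk, 0 < (firstForm X u).det := by
    intro u hu
    rw [det_firstForm, sq_pos_iff, norm_ne_zero_iff]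
    intro h0
    have := hJ u hu
    rw [h0, inner_zero_right] at this
    exact this.false
  have hH := hasDerivAt_bending hd₀ hd₂ ht₀ ht₂ hpos c₀ p
  have hK := hasDerivAt_total_curvature hd₀ hd₂ hb hpos
  have hcrit' := hcrit (fun u => ψ u • n) ((contDiff_radialProfile k).smul contDiff_const)
  have hvar : ∀ ε : ℝ, X + ε • (fun u => ψ u • n) = fun u => X u + (ε * ψ u) • n := fun ε => by
    ext1 u
    simp [smul_smul]
  have hbdry : ∀ ε : ℝ, boundaryCurve (X + ε • (fun u => ψ u • n)) = boundaryCurve X := fun ε => by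
    ext1 t
    simp [boundaryCurve, hψdef, radialProfile_circle]
  have hE := ((hH.const_mul σ).add (hK.const_mul η)).add_const
    (boundaryIntegral X fun t => Λ (curvature (boundaryCurve X) t) +
      ϖ * torsion (boundaryCurve X) t + β)
  have h0 := hcrit'.unique (hE.congr_of_eventuallyEq (Eventually.of_forall fun ε => by
    simp only [energy, boundaryIntegral, hbdry, Pi.add_apply]
    rw [hvar]
    congr 3
    · refine surfaceIntegral_eq fun u hu => ?_
      rw [meanCurvature_normalVariation hX2 hn hcb hψ ε hu,
        det_firstForm_normalVariation hX2 hn hcb hψ ε hu]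
      rfl
    · refine surfaceIntegral_eq fun u hu => ?_
      rw [gaussCurvature_normalVariation hX2 hn hcb hψ ε hu,
        det_firstForm_normalVariation hX2 hn hcb hψ ε hu]))
  have hI : ∫ u in disk, adjTrace (firstForm X u 0 0) (firstForm X u 0 1) (firstForm X u 1 1)
      (fun i j => variationForm X n ψ i j u) / (firstForm X u).det ≠ 0 :=
    integral_disk_ne_zero (ContinuousOn.div ht₀.continuousOn hd₀.continuousOn
      fun u hu => (hpos u hu).ne') fun u hu hu0 => div_neg_of_neg_of_pos (hk u hu hu0) (hpos u hu)
  have hp' : (p : ℝ) ≠ 0 := Nat.cast_ne_zero.2 hp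
  simp only [mul_zero, add_zero, zero_eq_mul, div_eq_zero_iff, mul_eq_zero, hσ.ne', hI, hp',
    two_ne_zero, or_false, false_or] at h0
  -- For `p = 1` the power is `1`, so `h0` is absurd: no planar disk is critical then.
  exact neg_eq_zero.1 (eq_zero_of_pow_eq_zero h0)

end Criticality

/-! ### Passage to the arc length parameter. -/

section ArcLength

variable {γ : ℝ → Space} {θ : ℝ → ℝ}

theorem deriv_arcLength (hγ : Differentiable ℝ γ) (hθ : Differentiable ℝ θ)
    (hθ' : ∀ s, 0 < deriv θ s) (h1 : ∀ s, ‖deriv (γ ∘ θ) s‖ = 1) (s : ℝ) :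
    ‖deriv γ (θ s)‖ * deriv θ s = 1 := by
  have := h1 s
  rwa [((hγ (θ s)).hasDerivAt.scomp s (hθ s).hasDerivAt).deriv, norm_smul,
    Real.norm_of_nonneg (hθ' s).le, mul_comm] at this

theorem arcDeriv_arcLength (hγ : Differentiable ℝ γ) (hθ : Differentiable ℝ θ)
    (hθ' : ∀ s, 0 < deriv θ s) (h1 : ∀ s, ‖deriv (γ ∘ θ) s‖ = 1) {W : ℝ → Space}
    (hW : Differentiable ℝ W) : arcDeriv (γ ∘ θ) (W ∘ θ) = arcDeriv γ W ∘ θ := by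
  ext1 s
  have h := eq_inv_of_mul_eq_one_right (deriv_arcLength hγ hθ hθ' h1 s)
  rw [arcDeriv, h1, inv_one, one_smul,
    ((hW (θ s)).hasDerivAt.scomp s (hθ s).hasDerivAt).deriv, h]
  rfl

theorem curvature_arcLength (hγ : ContDiff ℝ 2 γ) (h0 : ∀ t, deriv γ t ≠ 0)
    (hθ : Differentiable ℝ θ) (hθ' : ∀ s, 0 < deriv θ s) (h1 : ∀ s, ‖deriv (γ ∘ θ) s‖ = 1) :
    curvature (γ ∘ θ) = curvature γ ∘ θ := by
  have hγd : Differentiable ℝ γ := hγ.differentiable (by norm_num)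
  have hT : ContDiff ℝ (1 : ℕ∞) (tangent γ) :=
    contDiff_arcDeriv (by simpa [one_add_one_eq_two] using hγ)
      (by simpa [one_add_one_eq_two] using hγ) h0
  have hTθ : tangent (γ ∘ θ) = tangent γ ∘ θ := arcDeriv_arcLength hγd hθ hθ' h1 hγd
  ext1 s
  rw [curvature, hTθ, arcDeriv_arcLength hγd hθ hθ' h1 (hT.differentiable (by norm_num))]
  rfl

/-- Continuity of `deriv θ` is not assumed, so the fundamental theorem is applied to the primitive
of `g ‖γ'‖` composed with `θ`; by unit speed its derivative is the continuous function `g ∘ θ`. -/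
theorem integral_comp_arcLength (hγ : ContDiff ℝ 1 γ) (hθ : Differentiable ℝ θ)
    (hθ' : ∀ s, 0 < deriv θ s) (h1 : ∀ s, ‖deriv (γ ∘ θ) s‖ = 1) {g : ℝ → ℝ} (hg : Continuous g)
    (a b : ℝ) : ∫ s in a..b, g (θ s) = ∫ t in (θ a)..(θ b), g t * ‖deriv γ t‖ := by
  have hc : Continuous fun t => g t * ‖deriv γ t‖ :=
    hg.mul (hγ.continuous_deriv (by norm_num)).norm
  have hd : ∀ s, HasDerivAt (fun s => ∫ t in (0 : ℝ)..(θ s), g t * ‖deriv γ t‖) (g (θ s)) s := by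
    intro s
    have h := (hc.integral_hasStrictDerivAt 0 (θ s)).hasDerivAt.comp s (hθ s).hasDerivAt
    rwa [mul_assoc, deriv_arcLength (hγ.differentiable (by norm_num)) hθ hθ' h1, mul_one] at h
  rw [intervalIntegral.integral_eq_sub_of_hasDerivAt (fun s _ => hd s)
    ((hg.comp hθ.continuous).intervalIntegrable _ _),
    intervalIntegral.integral_interval_sub_left (hc.intervalIntegrable _ _)
      (hc.intervalIntegrable _ _)]

/-- Advancing the arc length by the total length advances the parameter by one period. -/
theorem arcLength_add_length (hγ : ContDiff ℝ 1 γ) (h0 : ∀ t, deriv γ t ≠ 0) {ω : ℝ}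
    (hper : Function.Periodic γ ω) (hθ : Differentiable ℝ θ) (hθ' : ∀ s, 0 < deriv θ s)
    (h1 : ∀ s, ‖deriv (γ ∘ θ) s‖ = 1) (s : ℝ) :
    θ (s + ∫ t in (0 : ℝ)..ω, ‖deriv γ t‖) = θ s + ω := by
  have hv : Continuous fun t => ‖deriv γ t‖ := (hγ.continuous_deriv (by norm_num)).norm
  have hpos : ∀ t, 0 < ‖deriv γ t‖ := fun t => norm_pos_iff.2 (h0 t)
  have hint : ∀ a b, IntervalIntegrable (fun t => ‖deriv γ t‖) volume a b := fun a b =>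
    hv.intervalIntegrable a b
  have hvper : Function.Periodic (fun t => ‖deriv γ t‖) ω := fun t => by
    simp only [periodic_deriv hper t]
  have h2 := integral_comp_arcLength hγ hθ hθ' h1 (continuous_const (y := (1 : ℝ))) s
    (s + ∫ t in (0 : ℝ)..ω, ‖deriv γ t‖)
  simp only [intervalIntegral.integral_const, add_sub_cancel_left, smul_eq_mul, mul_one,
    one_mul] at h2
  have h3 := hvper.intervalIntegral_add_eq 0 (θ s)
  rw [zero_add] at h3
  have h4 := intervalIntegral.integral_interval_sub_left (hint (θ s) (θ s + ω))
    (hint (θ s) (θ (s + ∫ t in (0 : ℝ)..ω, ‖deriv γ t‖)))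
  rw [← h2, ← h3, sub_self] at h4
  -- The arcs from `θ s` to either candidate endpoint have equal length, and the speed is positive,
  -- so the endpoints coincide.
  rcases lt_trichotomy (θ (s + ∫ t in (0 : ℝ)..ω, ‖deriv γ t‖)) (θ s + ω) with h | h | h
  · exact absurd h4 (intervalIntegral.intervalIntegral_pos_of_pos (hint _ _) hpos h).ne
  · exact h
  · rw [intervalIntegral.integral_symm, zero_eq_neg] at h4
    exact absurd h4 (intervalIntegral.intervalIntegral_pos_of_pos (hint _ _) hpos h).ne'

end ArcLength

end PWillmore

end

theorem mainTheorem11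
    (r : ℕ∞) (hr : 4 ≤ r)
    (σ c₀ η ϖ β : ℝ) (hσ : 0 < σ) (p : ℕ) (hp : p ≠ 0)
    (Λ : ℝ → ℝ) (U : Set ℝ) (hU : IsOpen U) (hΛ : AnalyticOnNhd ℝ Λ U)
    (X : PWillmore.Plane → PWillmore.Space)
    (hX : PWillmore.IsDiskImmersion r X)
    (hplanar : PWillmore.IsPlanar X)
    (hκ : ∀ t, PWillmore.curvature (PWillmore.boundaryCurve X) t ∈ U)
    (hcrit : PWillmore.IsCritical r (PWillmore.energy σ c₀ p η ϖ β Λ) X)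
    (C : ℝ → PWillmore.Space) (hC : PWillmore.IsArcLengthBoundary X C)
    (ρ : ℝ) (hρ : Function.Periodic (PWillmore.curvature C) ρ) :
    ∫ s in (0 : ℝ)..ρ,
      (PWillmore.curvature C s * deriv Λ (PWillmore.curvature C s)
        - Λ (PWillmore.curvature C s) - β) = 0 := by
  obtain rfl := PWillmore.spontaneousCurvature_eq_zero hr hσ hp hX hplanar hcrit
  have hint := PWillmore.integral_rescaling_eq_zero hr σ η ϖ β hp hU hΛ hX hplanar hκ hcrit
  obtain ⟨θ, hθ, hθ', rfl, h1⟩ := hC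
  have hγ : ContDiff ℝ 2 (PWillmore.boundaryCurve X) :=
    PWillmore.contDiff_boundaryCurve (hX.contDiff.of_le (by
      have h2 : (2 : ℕ∞) ≤ r := le_trans (by norm_num) hr
      exact WithTop.coe_le_coe.2 h2))
  have hγ1 : ContDiff ℝ 1 (PWillmore.boundaryCurve X) := hγ.of_le (by norm_num)
  have hγ0 := PWillmore.deriv_boundaryCurve_ne_zero (by rintro rfl; simp at hr) hX
  have hper := PWillmore.periodic_boundaryCurve X
  have hκper := PWillmore.periodic_curvature hper
  have hκc := PWillmore.continuous_curvature hγ hγ0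
  rw [PWillmore.curvature_arcLength hγ hγ0 hθ hθ' h1] at hρ ⊢
  set γ := PWillmore.boundaryCurve X
  set κ := PWillmore.curvature γ
  have hg : Continuous fun t => κ t * deriv Λ (κ t) - Λ (κ t) - β :=
    ((hκc.mul (hΛ.deriv.continuousOn.comp_continuous hκc hκ)).sub
      (hΛ.continuousOn.comp_continuous hκc hκ)).sub continuous_const
  have hL : 0 < ∫ t in (0 : ℝ)..(2 * Real.pi), ‖deriv γ t‖ :=
    intervalIntegral.intervalIntegral_pos_of_pos
      ((hγ1.continuous_deriv (by norm_num)).norm.intervalIntegrable _ _)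
      (fun t => norm_pos_iff.2 (hγ0 t)) (by positivity)
  have hshift := PWillmore.arcLength_add_length hγ1 hγ0 hper hθ hθ' h1
  refine PWillmore.integral_eq_zero_of_periodic (hg.comp hθ.continuous) hL ?_ ?_ ?_
  · intro s
    simp only [Function.comp_apply, hshift, hκper (θ s)]
  · intro s
    have h := hρ s
    simp only [Function.comp_apply] at h ⊢
    rw [h]
  -- Over one length `L` the parameter runs from `θ 0` to `θ 0 + 2π`; periodicity moves this
  -- interval to `[0, 2π]`, where the rescaling identity applies.
  · have hsub := PWillmore.integral_comp_arcLength hγ1 hθ hθ' h1 hg 0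
      (∫ t in (0 : ℝ)..(2 * Real.pi), ‖deriv γ t‖)
    have h0 := hshift 0
    rw [zero_add] at h0
    have hper' : Function.Periodic (fun t => (κ t * deriv Λ (κ t) - Λ (κ t) - β) * ‖deriv γ t‖)
        (2 * Real.pi) := fun t => by
      simp only [hκper t, PWillmore.periodic_deriv hper t]
    rw [h0, hper'.intervalIntegral_add_eq (θ 0) 0, zero_add, hint] at hsub
    exact hsub
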